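/- For a real matrix $A$ with $n$ rows, let $P_{[A]}$ be the orthogonal projection of $\mathbb R^n$ onto the span $[A]$ of the columns of $A$, and let $|||\cdot|||$ be the operator norm for the Euclidean norm. Let $\rho(A)$ and $\rho_{\min}(A)$ be the largest and the smallest eigenvalue of a square matrix $A$ with real eigenvalues, and let $\mathrm{Cond}(A)=\rho(A)/\rho_{\min}(A)$ for $A$ symmetric positive definite. Let $\delta\in(0,1)$. There are constants $d_\delta>0$ and $D_\delta>0$, depending only on $\delta$, such that the following holds for all $n,K\ge 1$, every $H\in\mathbb R^{n\times K}$ of full rank $K$, every symmetric positive semidefinite $S\in\mathbb R^{K\times K}$ and every $\gamma\in\mathbb R$. Let $\hat H=H+E$, where $E$ is a random $n\times K$ matrix whose rows are independent with $E_{i,\cdot}^T\sim\mathcal N_K(0,\gamma^2S)$ for $1\le i\le n$, and assume $$\tfrac14\,\rho_{\min}(H^TH)>d_\delta\, n\,\gamma^2\rho(S).$$ Then, with probability at least $1-\delta$, both of the following inequalities hold: $$\frac1n|||P_{[H]}-P_{[\hat H]}|||^2\le D_\delta\,\gamma^2\,\mathrm{Cond}(H^TH)^3\,\frac{\rho(S)}{\rho_{\min}(H^TH)},$$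 $$\frac1n|||P_{[H]}-P_{[\hat H]}|||^2\le D_\delta\,\gamma^2\,\mathrm{Cond}(H^TH)\max\Big(\frac Kn\mathrm{Cond}(H^TH)^2\rho\big(S(H^TH)^{-1}\big),\ \rho\big(S(H^TH)^{-1}\big),\ \mathrm{Cond}(H^TH)^2\frac{\mathrm{Tr}(S)}{n\,\rho_{\min}(H^TH)}\Big).$$ -/

import Mathlib

open MeasureTheory ProbabilityTheory

namespace ProjEst

noncomputable section

/-- The largest eigenvalue of a real square matrix. In the theorem it is applied to symmetric
positive semidefinite matrices `S` and `HᵀH` and to `S (HᵀH)⁻¹`, which is similar to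
`(HᵀH)^(-1/2) S (HᵀH)^(-1/2)`; all their eigenvalues are real and nonnegative. -/
def rho {K : ℕ} (A : Matrix (Fin K) (Fin K) ℝ) : ℝ := sSup (spectrum ℝ A)

/-- The smallest eigenvalue of a real symmetric matrix. -/
def rhoMin {K : ℕ} (A : Matrix (Fin K) (Fin K) ℝ) : ℝ := sInf (spectrum ℝ A)

/-- The condition number of a symmetric positive definite matrix. -/
def condNumber {K : ℕ} (A : Matrix (Fin K) (Fin K) ℝ) : ℝ := rho A / rhoMin A

/-- The subspace `[A]` of `ℝⁿ` spanned by the columns of `A`. -/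
def colSpan {n K : ℕ} (A : Matrix (Fin n) (Fin K) ℝ) :
    Submodule ℝ (EuclideanSpace ℝ (Fin n)) :=
  Submodule.span ℝ (Set.range fun j : Fin K => WithLp.toLp 2 fun i : Fin n => A i j)

/-- The orthogonal projection `P_[A]` of `ℝⁿ` onto `[A]`; the norm on this space of continuous
linear maps is the operator norm for the Euclidean norm. -/
def proj {n K : ℕ} (A : Matrix (Fin n) (Fin K) ℝ) :
    EuclideanSpace ℝ (Fin n) →L[ℝ] EuclideanSpace ℝ (Fin n) :=
  (colSpan A).starProjection

/-- The `i`-th row of `A`, as a vector of the Euclidean space `ℝᴷ`. -/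
def rowVec {n K : ℕ} (A : Matrix (Fin n) (Fin K) ℝ) (i : Fin n) : EuclideanSpace ℝ (Fin K) :=
  WithLp.toLp 2 (A i)

end

end ProjEst

/-! If `‖E w‖ ≤ ε * ‖H w‖` for all `w`, the two projections differ by at most `4 * ε`
(`norm_proj_sub_le`). So it suffices to bound `E` relative to `H`. Put `G = HᵀH` and `r = rho (S *
G⁻¹)`. Since `S ≤ r • G`, each row of `E` paired with `w` is Gaussian of variance at most `γ² r ‖H
w‖²`. Instead of a net, the exponential of `a * ‖E v‖²` on the ellipsoid `‖H v‖ ≤ 1` is controlled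
by its average over the doubled ellipsoid. Fubini, independence and Markov then give `‖E v‖² ≤ 16 γ²
r n log (4/δ) ‖H v‖²` for all `v` at once, outside an event of probability at most `δ`
(`measure_exists_lt_norm_innerMap_sq_le`). The resulting bound `256 log (4/δ) γ² r` is stronger than
both claims, because `r ≤ rho S / rhoMin G` and the condition number is at least 1. -/

namespace ProjEst

/-! ### Perturbation of orthogonal projections. -/

/-- Nearby injective images have nearby orthogonal projections. -/
lemma norm_starProjection_sub_le {W F : Type*} [NormedAddCommGroup F] [InnerProductSpace ℝ F]
    [FiniteDimensional ℝ F] (A B : W → F) (U V : Submodule ℝ F)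
    (hU : ∀ x, x ∈ U ↔ ∃ w, A w = x) (hV : ∀ x, x ∈ V ↔ ∃ w, B w = x) (ε : ℝ)
    (hε : 0 ≤ ε) (hAB : ∀ w, ‖B w - A w‖ ≤ ε * ‖A w‖) :
    ‖U.starProjection - V.starProjection‖ ≤ 4 * ε := by
  have hdist : ∀ (Y : Submodule ℝ F) (x y : F), y ∈ Y → ‖x - Y.starProjection x‖ ≤ ‖x - y‖ := by
    intro Y x y hy
    have h := Yᗮ.norm_starProjection_apply_le (x - y)
    rw [Submodule.starProjection_orthogonal_val, map_sub,
      Submodule.starProjection_eq_self_iff.2 hy] at h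
    simpa using h
  rcases le_or_gt (1 / 2) ε with h | h
  · have h1 := norm_sub_le U.starProjection V.starProjection
    have h2 := U.starProjection_norm_le
    have h3 := V.starProjection_norm_le
    linarith
  have h1 : ‖U.starProjection - V.starProjection * U.starProjection‖ ≤ ε := by
    refine ContinuousLinearMap.opNorm_le_bound _ hε fun x => ?_
    obtain ⟨w, hw⟩ := (hU _).1 (U.starProjection_apply_mem x)
    have h1 := hdist V (A w) (B w) ((hV _).2 ⟨w, rfl⟩)
    have h2 := hAB w
    rw [norm_sub_rev] at h2
    have h3 := U.norm_starProjection_apply_le x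
    rw [← hw] at h3
    change ‖U.starProjection x - V.starProjection (U.starProjection x)‖ ≤ _
    rw [← hw]
    have h4 := mul_le_mul_of_nonneg_left h3 hε
    linarith
  have h2 : ‖V.starProjection - U.starProjection * V.starProjection‖ ≤ 2 * ε := by
    refine ContinuousLinearMap.opNorm_le_bound _ (by positivity) fun x => ?_
    obtain ⟨w, hw⟩ := (hV _).1 (V.starProjection_apply_mem x)
    have h1 := hdist U (B w) (A w) ((hU _).2 ⟨w, rfl⟩)
    have h2 := hAB w
    have h3 := V.norm_starProjection_apply_le x
    rw [← hw] at h3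
    change ‖V.starProjection x - U.starProjection (V.starProjection x)‖ ≤ _
    rw [← hw]
    have h5 : ‖A w‖ ≤ ‖B w‖ + ‖B w - A w‖ := by
      have := norm_sub_le (B w) (B w - A w)
      simpa using this
    -- As `ε < 1/2`, half of `‖A w‖` can be absorbed on the left.
    have h6 : ‖A w‖ ≤ 2 * ‖x‖ := by nlinarith [norm_nonneg (A w)]
    have h7 := mul_le_mul_of_nonneg_left h6 hε
    linarith
  -- Taking adjoints swaps the factors; both projections are then compared with `V U`, for a total
  -- of `3 * ε`.
  have h3 : ‖V.starProjection - V.starProjection * U.starProjection‖ ≤ 2 * ε := by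
    rw [← norm_star, star_sub, star_mul, (isSelfAdjoint_starProjection U).star_eq,
      (isSelfAdjoint_starProjection V).star_eq]
    exact h2
  have h4 := norm_sub_le (U.starProjection - V.starProjection * U.starProjection)
    (V.starProjection - V.starProjection * U.starProjection)
  rw [sub_sub_sub_cancel_right] at h4
  linarith

lemma mem_colSpan {n K : ℕ} (A : Matrix (Fin n) (Fin K) ℝ) (x : EuclideanSpace ℝ (Fin n)) :
    x ∈ colSpan A ↔ ∃ w : Fin K → ℝ, WithLp.toLp 2 (A.mulVec w) = x := by
  rw [colSpan, Submodule.mem_span_range_iff_exists_fun]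
  refine exists_congr fun w => ?_
  have : WithLp.toLp 2 (A.mulVec w) =
      ∑ j, w j • (WithLp.toLp 2 fun i => A i j : EuclideanSpace ℝ (Fin n)) := by
    ext i
    simp [Matrix.mulVec, dotProduct, mul_comm]
  rw [this]

lemma norm_proj_sub_le {n K : ℕ} (H E : Matrix (Fin n) (Fin K) ℝ) (ε : ℝ) (hε : 0 ≤ ε)
    (h : ∀ w : Fin K → ℝ, ‖(WithLp.toLp 2 (E.mulVec w) : EuclideanSpace ℝ (Fin n))‖ ≤
      ε * ‖(WithLp.toLp 2 (H.mulVec w) : EuclideanSpace ℝ (Fin n))‖) :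
    ‖proj H - proj (H + E)‖ ≤ 4 * ε := by
  refine norm_starProjection_sub_le (fun w : Fin K → ℝ => WithLp.toLp 2 (H.mulVec w))
    (fun w : Fin K → ℝ => WithLp.toLp 2 ((H + E).mulVec w)) _ _ (mem_colSpan H)
    (mem_colSpan (H + E)) ε hε fun w => ?_
  rw [← WithLp.toLp_sub, Matrix.add_mulVec, add_sub_cancel_left]
  exact h w

/-! ### Extreme eigenvalues and the Loewner order. -/

section Spectrum

open scoped MatrixOrder Matrix.Norms.L2Operator

variable {K : ℕ}

lemma posSemidef_smul_one_sub_iff {Q : Matrix (Fin K) (Fin K) ℝ} (hQ : Q.IsHermitian) (r : ℝ) :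
    (r • (1 : Matrix (Fin K) (Fin K) ℝ) - Q).PosSemidef ↔ ∀ x ∈ spectrum ℝ Q, x ≤ r := by
  have hH : (r • (1 : Matrix (Fin K) (Fin K) ℝ) - Q).IsHermitian :=
    ((Matrix.isHermitian_one).smul (IsSelfAdjoint.all r)).sub hQ
  rw [Matrix.posSemidef_iff_isHermitian_and_spectrum_nonneg, ← Algebra.algebraMap_eq_smul_one,
    ← spectrum.singleton_sub_eq]
  rw [← Algebra.algebraMap_eq_smul_one] at hH
  rw [and_iff_right hH]
  simp [Set.subset_def]

/-- Write `G = B* B`. Congruence by `B⁻¹` turns `r • G - S` into `r • 1 - Q` with `Q = B⁻* S B⁻¹`,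
and `Q` has the same characteristic polynomial as `S * G⁻¹`. -/
lemma posSemidef_smul_sub_iff {S G : Matrix (Fin K) (Fin K) ℝ} (hS : S.IsHermitian)
    (hG : G.PosDef) (r : ℝ) :
    (r • G - S).PosSemidef ↔ ∀ x ∈ spectrum ℝ (S * G⁻¹), x ≤ r := by
  obtain ⟨B, hB, rfl⟩ := CStarAlgebra.isStrictlyPositive_iff_eq_star_mul_self.1
    hG.isStrictlyPositive
  rw [Matrix.star_eq_conjTranspose] at hG ⊢
  have hBdet := (Matrix.isUnit_iff_isUnit_det _).1 hB
  have hBinv : B⁻¹ * B = 1 := Matrix.nonsing_inv_mul _ hBdet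
  have hBinv' : B * B⁻¹ = 1 := Matrix.mul_nonsing_inv _ hBdet
  have hBs : B.conjTranspose * (B⁻¹).conjTranspose = 1 := by
    rw [← Matrix.conjTranspose_mul, hBinv, Matrix.conjTranspose_one]
  have hBs' : (B⁻¹).conjTranspose * B.conjTranspose = 1 := by
    rw [← Matrix.conjTranspose_mul, hBinv', Matrix.conjTranspose_one]
  have hQ : ((B⁻¹).conjTranspose * S * B⁻¹).IsHermitian :=
    Matrix.isHermitian_conjTranspose_mul_mul _ hS
  have hspec : spectrum ℝ (S * (B.conjTranspose * B)⁻¹) =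
      spectrum ℝ ((B⁻¹).conjTranspose * S * B⁻¹) := by
    ext x
    rw [Matrix.mem_spectrum_iff_isRoot_charpoly, Matrix.mem_spectrum_iff_isRoot_charpoly,
      Matrix.mul_inv_rev, ← mul_assoc, Matrix.charpoly_mul_comm, Matrix.conjTranspose_nonsing_inv,
      mul_assoc]
  rw [hspec, ← posSemidef_smul_one_sub_iff hQ]
  constructor
  · intro h
    have := h.conjTranspose_mul_mul_same B⁻¹
    rwa [mul_sub, sub_mul, mul_smul_comm, smul_mul_assoc, ← mul_assoc, hBs', one_mul, hBinv'] at this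
  · intro h
    have := h.conjTranspose_mul_mul_same B
    have h2 : B.conjTranspose * ((B⁻¹).conjTranspose * S * B⁻¹) * B = S := by
      calc _ = (B.conjTranspose * (B⁻¹).conjTranspose) * S * (B⁻¹ * B) := by
            simp only [mul_assoc]
        _ = S := by rw [hBs, hBinv, one_mul, mul_one]
    rwa [mul_sub, sub_mul, h2, mul_smul_comm, smul_mul_assoc, mul_one] at this

lemma bddAbove_spectrum (A : Matrix (Fin K) (Fin K) ℝ) : BddAbove (spectrum ℝ A) :=
  (Matrix.finite_spectrum A).bddAbove

lemma posSemidef_rho_smul_sub {S G : Matrix (Fin K) (Fin K) ℝ} (hS : S.IsHermitian)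
    (hG : G.PosDef) : (rho (S * G⁻¹) • G - S).PosSemidef :=
  (posSemidef_smul_sub_iff hS hG _).2 fun _ hx => le_csSup (bddAbove_spectrum _) hx

lemma posSemidef_sub_rhoMin_smul_one {G : Matrix (Fin K) (Fin K) ℝ} (hG : G.IsHermitian) :
    (G - rhoMin G • (1 : Matrix (Fin K) (Fin K) ℝ)).PosSemidef := by
  have hH : (G - rhoMin G • (1 : Matrix (Fin K) (Fin K) ℝ)).IsHermitian :=
    hG.sub ((Matrix.isHermitian_one).smul (IsSelfAdjoint.all _))
  rw [Matrix.posSemidef_iff_isHermitian_and_spectrum_nonneg, ← Algebra.algebraMap_eq_smul_one,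
    ← spectrum.sub_singleton_eq]
  rw [← Algebra.algebraMap_eq_smul_one] at hH
  refine ⟨hH, ?_⟩
  rintro _ ⟨x, hx, _, rfl, rfl⟩
  exact sub_nonneg.2 (csInf_le (Matrix.finite_spectrum G).bddBelow hx)

lemma rho_nonneg {S G : Matrix (Fin K) (Fin K) ℝ} (hS : S.PosSemidef) (hG : G.PosDef) :
    0 ≤ rho (S * G⁻¹) := by
  rcases isEmpty_or_nonempty (Fin K) with hK | hK
  · simp [rho, spectrum.of_subsingleton]
  have h := posSemidef_rho_smul_sub hS.isHermitian hG
  obtain ⟨k⟩ := hK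
  have h1 := hG.diag_pos (i := k)
  -- The sum `(r • G - S) + S` is `r • G`, whose diagonal has the sign of `r`.
  have h2 := (h.add hS).diag_nonneg (i := k)
  simp at h2
  exact (mul_nonneg_iff_of_pos_right h1).1 h2

lemma rho_mul_inv_le {S G : Matrix (Fin K) (Fin K) ℝ} (hS : S.PosSemidef) (hG : G.PosDef)
    (hm : 0 < rhoMin G) : rho (S * G⁻¹) ≤ rho S / rhoMin G := by
  have hone := Matrix.PosDef.one (n := Fin K) (R := ℝ)
  have h0 : 0 ≤ rho S := by simpa using rho_nonneg hS hone
  have h1 := posSemidef_rho_smul_sub hS.isHermitian hone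
  have h2 := (posSemidef_sub_rhoMin_smul_one hG.isHermitian).smul (div_nonneg h0 hm.le)
  have h3 := h1.add h2
  have h4 : rho (S * 1⁻¹) • (1 : Matrix (Fin K) (Fin K) ℝ) - S +
      (rho S / rhoMin G) • (G - rhoMin G • (1 : Matrix (Fin K) (Fin K) ℝ)) =
      (rho S / rhoMin G) • G - S := by
    rw [smul_sub, smul_smul, div_mul_cancel₀ _ hm.ne', inv_one, mul_one]
    abel
  rw [h4] at h3
  exact Real.sSup_le ((posSemidef_smul_sub_iff hS.isHermitian hG _).1 h3)
    (div_nonneg h0 hm.le)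

lemma one_le_condNumber {G : Matrix (Fin K) (Fin K) ℝ} (hm : 0 < rhoMin G) :
    1 ≤ condNumber G := by
  rw [condNumber, one_le_div hm]
  have hne : (spectrum ℝ G).Nonempty := by
    by_contra h
    rw [Set.not_nonempty_iff_eq_empty] at h
    simp [rhoMin, h] at hm
  exact csInf_le_csSup hne (Matrix.finite_spectrum G).bddBelow (bddAbove_spectrum G)

end Spectrum

/-! ### Exponential moments and averaging. -/

lemma lintegral_exp_mul_sq_gaussianReal_le (v : NNReal) (a : ℝ)
    (hav : 4 * a * v ≤ 1) :
    ∫⁻ x, ENNReal.ofReal (Real.exp (a * x ^ 2)) ∂(gaussianReal 0 v) ≤ 2 := by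
  rcases eq_or_ne v 0 with rfl | hv
  · rw [gaussianReal_zero_var, lintegral_dirac]
    simp
  have hv' : (0 : ℝ) < v := by positivity
  set b : ℝ := 1 / (2 * v) - a with hb
  -- The integral equals `1 / √(2 v b)`, hence is at most `√2`.
  have hb4 : 1 / (4 * v) ≤ b := by
    rw [hb, div_le_iff₀ (by positivity), sub_mul, div_mul_eq_mul_div,
      show 1 * (4 * (v : ℝ)) = 2 * (2 * v) by ring, mul_div_cancel_right₀ _ (by positivity)]
    linarith
  have hbpos : 0 < b := lt_of_lt_of_le (by positivity) hb4
  rw [gaussianReal_of_var_ne_zero _ hv, lintegral_withDensity_eq_lintegral_mul _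
    (measurable_gaussianPDF 0 v) (by fun_prop)]
  have h1 : ∀ x : ℝ, (gaussianPDF 0 v * fun x => ENNReal.ofReal (Real.exp (a * x ^ 2))) x =
      ENNReal.ofReal ((√(2 * Real.pi * v))⁻¹ * Real.exp (-b * x ^ 2)) := by
    intro x
    rw [Pi.mul_apply, gaussianPDF, ← ENNReal.ofReal_mul (gaussianPDFReal_nonneg _ _ _),
      gaussianPDFReal, mul_assoc, ← Real.exp_add]
    congr 3
    rw [hb]
    field_simp
    ring
  simp_rw [h1]
  rw [← ofReal_integral_eq_lintegral_ofReal ((integrable_exp_neg_mul_sq hbpos).const_mul _)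
    (Filter.Eventually.of_forall fun x => by positivity), integral_const_mul, integral_gaussian]
  refine ENNReal.ofReal_le_of_le_toReal ?_
  rw [ENNReal.toReal_ofNat, ← Real.sqrt_inv, ← Real.sqrt_mul (by positivity),
    Real.sqrt_le_left (by norm_num)]
  rw [div_le_iff₀ (by positivity)] at hb4
  rw [← div_eq_inv_mul, div_div, div_le_iff₀ (by positivity)]
  nlinarith [Real.pi_pos]

/-- The average of `exp (a ‖A w‖ ^ 2)` over the ball `‖L w‖ ≤ 2` controls its values on the ball
`‖L v‖ ≤ 1`. -/
lemma exp_norm_sq_mul_volume_le {W F G : Type*} [NormedAddCommGroup W] [InnerProductSpace ℝ W]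
    [FiniteDimensional ℝ W] [MeasurableSpace W] [BorelSpace W] [NormedAddCommGroup F]
    [InnerProductSpace ℝ F] [NormedAddCommGroup G] [NormedSpace ℝ G] (A : W →L[ℝ] F)
    (L : W →L[ℝ] G) (a : ℝ) (ha : 0 ≤ a) (v : W) (hv : ‖L v‖ ≤ 1) :
    ENNReal.ofReal (Real.exp (a * ‖A v‖ ^ 2)) * volume {u | ‖L u‖ ≤ 1} ≤
      ∫⁻ w in {w | ‖L w‖ ≤ 2}, ENNReal.ofReal (Real.exp (a * ‖A w‖ ^ 2)) := by
  set f : W → ENNReal := fun w => ENNReal.ofReal (Real.exp (a * ‖A w‖ ^ 2)) with hf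
  have hfm : Measurable f := by
    have : Continuous f := ENNReal.continuous_ofReal.comp (by fun_prop)
    exact this.measurable
  have hBm : MeasurableSet {w : W | ‖L w‖ ≤ 2} := (isClosed_le (by fun_prop) (by fun_prop)).measurableSet
  have hCm : MeasurableSet {w : W | ‖L w‖ ≤ 1} := (isClosed_le (by fun_prop) (by fun_prop)).measurableSet
  set g : W → ENNReal := {w : W | ‖L w‖ ≤ 2}.indicator f with hg
  have hgm : Measurable g := hfm.indicator hBm
  -- Midpoint convexity: the parallelogram law bounds the exponent at `v` by the mean of those at `v
  -- ± u`, and AM-GM passes to exponentials.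
  have hle : ∀ u ∈ {u : W | ‖L u‖ ≤ 1}, 2 * f v ≤ g (v + u) + g (v + -u) := by
    intro u hu
    have hu1 : v + u ∈ {w : W | ‖L w‖ ≤ 2} := by
      have := norm_add_le (L v) (L u)
      simp only [Set.mem_ofPred_eq, map_add] at hu ⊢
      linarith
    have hu2 : v + -u ∈ {w : W | ‖L w‖ ≤ 2} := by
      have := norm_add_le (L v) (-L u)
      rw [norm_neg] at this
      simp only [Set.mem_ofPred_eq, map_add, map_neg] at hu ⊢
      linarith
    rw [hg, Set.indicator_of_mem hu1, Set.indicator_of_mem hu2, hf]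
    simp only
    rw [← ENNReal.ofReal_add (Real.exp_pos _).le (Real.exp_pos _).le,
      ← ENNReal.ofReal_ofNat 2, ← ENNReal.ofReal_mul (by norm_num)]
    refine ENNReal.ofReal_le_ofReal ?_
    have hpar := parallelogram_law_with_norm ℝ (A v) (A u)
    rw [map_add, map_add, map_neg, ← sub_eq_add_neg]
    set x := a * ‖A v + A u‖ ^ 2
    set y := a * ‖A v - A u‖ ^ 2
    have hxy : a * ‖A v‖ ^ 2 ≤ x / 2 + y / 2 := by
      have : ‖A v‖ ^ 2 ≤ (‖A v + A u‖ ^ 2 + ‖A v - A u‖ ^ 2) / 2 := by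
        nlinarith [sq_nonneg ‖A u‖]
      have := mul_le_mul_of_nonneg_left this ha
      simp only [x, y]
      linarith
    have h1 := Real.exp_le_exp.2 hxy
    rw [Real.exp_add] at h1
    have h2 : Real.exp x = Real.exp (x / 2) ^ 2 := by
      rw [← Real.exp_nat_mul]; congr 1; push_cast; ring
    have h3 : Real.exp y = Real.exp (y / 2) ^ 2 := by
      rw [← Real.exp_nat_mul]; congr 1; push_cast; ring
    rw [h2, h3]
    nlinarith [sq_nonneg (Real.exp (x / 2) - Real.exp (y / 2))]
  have hint : ∫⁻ u in {u : W | ‖L u‖ ≤ 1}, 2 * f v ≤ 2 * ∫⁻ w, g w := by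
    calc _ ≤ ∫⁻ u in {u : W | ‖L u‖ ≤ 1}, (g (v + u) + g (v + -u)) :=
          setLIntegral_mono (by fun_prop) hle
      _ ≤ ∫⁻ u, (g (v + u) + g (v + -u)) := setLIntegral_le_lintegral _ _
      _ = 2 * ∫⁻ w, g w := by
          rw [lintegral_add_left (by fun_prop), lintegral_neg_eq_self (fun u => g (v + u)),
            lintegral_add_left_eq_self, two_mul]
  rw [setLIntegral_const, mul_assoc, hg, lintegral_indicator hBm] at hint
  exact (ENNReal.mul_le_mul_iff_right (by norm_num) (by norm_num)).1 hint

section InnerMap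

variable {W ι : Type*} [NormedAddCommGroup W] [InnerProductSpace ℝ W]

/-- The linear map whose coordinates are the inner products with the vectors `x i`. -/
noncomputable def innerMap (x : ι → W) : W →L[ℝ] EuclideanSpace ℝ ι :=
  (EuclideanSpace.equiv ι ℝ).symm.toContinuousLinearMap ∘L
    ContinuousLinearMap.pi fun i => innerSL ℝ (x i)

@[simp]
lemma innerMap_apply (x : ι → W) (w : W) (i : ι) : innerMap x w i = inner ℝ (x i) w := by
  simp [innerMap]

variable [Fintype ι]

lemma norm_innerMap_sq (x : ι → W) (w : W) : ‖innerMap x w‖ ^ 2 = ∑ i, inner ℝ (x i) w ^ 2 := by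
  simp [EuclideanSpace.norm_sq_eq]

lemma ofReal_exp_norm_innerMap_sq (x : ι → W) (w : W) (a : ℝ) :
    ENNReal.ofReal (Real.exp (a * ‖innerMap x w‖ ^ 2)) =
      ∏ i, ENNReal.ofReal (Real.exp (a * inner ℝ (x i) w ^ 2)) := by
  rw [norm_innerMap_sq, Finset.mul_sum, Real.exp_sum,
    ENNReal.ofReal_prod_of_nonneg fun i _ => (Real.exp_pos _).le]

end InnerMap

/-! ### Uniform concentration over an ellipsoid. -/

section Concentration

open scoped Pointwise

variable {W G ι Ω : Type*} [NormedAddCommGroup W] [InnerProductSpace ℝ W] [FiniteDimensional ℝ W]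
  [MeasurableSpace W] [BorelSpace W] [NormedAddCommGroup G] [NormedSpace ℝ G] [Fintype ι]
  [MeasurableSpace Ω]

lemma volume_norm_le_one_ne_zero (L : W →L[ℝ] G) :
    (volume : Measure W) {u | ‖L u‖ ≤ 1} ≠ 0 := by
  have ho : IsOpen {u : W | ‖L u‖ < 1} := isOpen_lt (by fun_prop) (by fun_prop)
  have hpos := ho.measure_pos (volume : Measure W) ⟨0, by simp⟩
  exact (hpos.trans_le (measure_mono fun u (hu : ‖L u‖ < 1) => hu.le)).ne'

lemma volume_norm_le_one_ne_top (L : W →L[ℝ] G) (hL : Function.Injective L) :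
    (volume : Measure W) {u | ‖L u‖ ≤ 1} ≠ ⊤ := by
  obtain ⟨c, -, hc⟩ := L.toLinearMap.exists_antilipschitzWith (LinearMap.ker_eq_bot.2 hL)
  refine ne_top_of_le_ne_top (measure_closedBall_lt_top (μ := (volume : Measure W)) (x := 0)
    (r := c)).ne (measure_mono fun u (hu : ‖L u‖ ≤ 1) => ?_)
  have h := hc.le_mul_dist u 0
  simp only [ContinuousLinearMap.coe_coe, map_zero, dist_zero_right] at h
  rw [mem_closedBall_zero_iff]
  exact h.trans (mul_le_of_le_one_right c.2 hu)

lemma volume_norm_le_two (L : W →L[ℝ] G) :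
    (volume : Measure W) {u | ‖L u‖ ≤ 2} =
      2 ^ Module.finrank ℝ W * volume {u | ‖L u‖ ≤ 1} := by
  have h : {u : W | ‖L u‖ ≤ 2} = (2 : ℝ) • {u : W | ‖L u‖ ≤ 1} := by
    ext u
    rw [Set.mem_smul_set_iff_inv_smul_mem₀ (by norm_num)]
    simp only [Set.mem_ofPred_eq, map_smul, norm_smul, norm_inv, Real.norm_ofNat]
    rw [inv_mul_le_iff₀ (by norm_num), mul_one]
  rw [h, Measure.addHaar_smul_of_nonneg _ (by norm_num), ENNReal.ofReal_pow (by norm_num),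
    ENNReal.ofReal_ofNat]

/-- Markov's inequality for the integral over `‖L w‖ ≤ 2`: independence contributes a factor 2 per
index, and the volume ratio of the two ellipsoids contributes `2 ^ finrank`. -/
lemma measure_exists_exp_norm_innerMap_sq_ge_le {μ : Measure Ω} [IsProbabilityMeasure μ]
    (X : ι → Ω → W)
    (hX : ∀ i, Measurable (X i)) (hind : iIndepFun X μ) (L : W →L[ℝ] G)
    (hL : Function.Injective L) (a : ℝ) (ha : 0 ≤ a)
    (hexp : ∀ w, ‖L w‖ ≤ 2 → ∀ i,
      ∫⁻ ω, ENNReal.ofReal (Real.exp (a * inner ℝ (X i ω) w ^ 2)) ∂μ ≤ 2)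
    (c : ENNReal) (hc0 : c ≠ 0) (hc : c ≠ ⊤) :
    μ {ω | ∃ v, ‖L v‖ ≤ 1 ∧
        c ≤ ENNReal.ofReal (Real.exp (a * ‖innerMap (X · ω) v‖ ^ 2))} ≤
      2 ^ Module.finrank ℝ W * 2 ^ Fintype.card ι / c := by
  set V : ENNReal := (volume : Measure W) {u | ‖L u‖ ≤ 1} with hV
  have hV0 : V ≠ 0 := volume_norm_le_one_ne_zero L
  have hVt : V ≠ ⊤ := volume_norm_le_one_ne_top L hL
  set f : Ω → W → ENNReal := fun ω w =>
    ENNReal.ofReal (Real.exp (a * ‖innerMap (X · ω) w‖ ^ 2)) with hf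
  have hfm : Measurable (Function.uncurry f) := by
    have : Function.uncurry f = fun p : Ω × W =>
        ∏ i, ENNReal.ofReal (Real.exp (a * inner ℝ (X i p.1) p.2 ^ 2)) := by
      ext p
      exact ofReal_exp_norm_innerMap_sq _ _ _
    rw [this]
    have hXi : ∀ i, Measurable fun p : Ω × W => X i p.1 := fun i => (hX i).comp measurable_fst
    fun_prop
  set Z : Ω → ENNReal := fun ω => ∫⁻ w in {w | ‖L w‖ ≤ 2}, f ω w with hZ
  have hZm : Measurable Z := hfm.lintegral_prod_right'
  have hEZ : ∫⁻ ω, Z ω ∂μ ≤ 2 ^ Module.finrank ℝ W * 2 ^ Fintype.card ι * V := by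
    rw [hZ, lintegral_lintegral_swap hfm.aemeasurable]
    calc _ ≤ ∫⁻ w in {w : W | ‖L w‖ ≤ 2}, (2 : ENNReal) ^ Fintype.card ι := by
          refine setLIntegral_mono measurable_const fun w hw => ?_
          simp only [hf, ofReal_exp_norm_innerMap_sq]
          have hg : Measurable fun x : W => ENNReal.ofReal (Real.exp (a * inner ℝ x w ^ 2)) := by
            fun_prop
          rw [lintegral_prod_eq_prod_lintegral_of_indepFun Finset.univ
            (fun i ω => ENNReal.ofReal (Real.exp (a * inner ℝ (X i ω) w ^ 2)))
            (hind.comp _ fun _ => hg) fun i => hg.comp (hX i)]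
          exact (Finset.prod_le_prod' fun i _ => hexp w hw i).trans (by simp)
      _ = _ := by
          rw [setLIntegral_const, volume_norm_le_two]
          ring
  have hsub : {ω | ∃ v, ‖L v‖ ≤ 1 ∧ c ≤ f ω v} ⊆ {ω | c * V ≤ Z ω} := by
    rintro ω ⟨v, hv, hcv⟩
    exact (mul_le_mul_left hcv V).trans (exp_norm_sq_mul_volume_le _ L a ha v hv)
  calc _ ≤ μ {ω | c * V ≤ Z ω} := measure_mono hsub
    _ ≤ (∫⁻ ω, Z ω ∂μ) / (c * V) := meas_ge_le_lintegral_div hZm.aemeasurable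
        (mul_ne_zero hc0 hV0) (ENNReal.mul_ne_top hc hVt)
    _ ≤ 2 ^ Module.finrank ℝ W * 2 ^ Fintype.card ι * V / (c * V) := by gcongr
    _ = _ := ENNReal.mul_div_mul_right _ _ hV0 hVt

end Concentration

/-! ### Gaussian rows. -/

section Gaussian

variable {Ω : Type*} [MeasurableSpace Ω] {μ : Measure Ω} {K n : ℕ}

lemma hasLaw_inner_multivariateGaussian {X : Ω → EuclideanSpace ℝ (Fin K)}
    {T : Matrix (Fin K) (Fin K) ℝ} (hT : T.PosSemidef)
    (hX : HasLaw X (multivariateGaussian 0 T) μ) (w : EuclideanSpace ℝ (Fin K)) :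
    HasLaw (fun ω => inner ℝ (X ω) w)
      (gaussianReal 0 (w.ofLp ⬝ᵥ T.mulVec w.ofLp).toNNReal) μ := by
  have h : HasLaw (innerSL ℝ w) (gaussianReal 0 (w.ofLp ⬝ᵥ T.mulVec w.ofLp).toNNReal)
      (multivariateGaussian 0 T) := by
    refine ⟨by fun_prop, ?_⟩
    rw [IsGaussian.map_eq_gaussianReal, ContinuousLinearMap.integral_comp_id_comm
      IsGaussian.integrable_id, integral_id_multivariateGaussian, map_zero,
      ← covarianceBilin_multivariateGaussian hT (μ := 0),
      covarianceBilin_self IsGaussian.memLp_two_id]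
    rfl
  have h2 := h.fun_comp hX
  simp only [innerSL_apply_apply] at h2
  simpa only [real_inner_comm] using h2

lemma ae_eq_zero_of_quadratic_form_nonpos {X : Ω → EuclideanSpace ℝ (Fin K)}
    {T : Matrix (Fin K) (Fin K) ℝ} (hT : T.PosSemidef)
    (hX : HasLaw X (multivariateGaussian 0 T) μ)
    (h0 : ∀ w : Fin K → ℝ, w ⬝ᵥ T.mulVec w ≤ 0) : ∀ᵐ ω ∂μ, X ω = 0 := by
  have h : ∀ j, ∀ᵐ ω ∂μ, X ω j = 0 := by
    intro j
    have h1 := hasLaw_inner_multivariateGaussian hT hX (EuclideanSpace.single j 1)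
    rw [Real.toNNReal_of_nonpos (h0 _), gaussianReal_zero_var] at h1
    filter_upwards [h1.ae_eq_of_dirac] with ω hω
    simpa [EuclideanSpace.inner_single_right] using hω
  filter_upwards [ae_all_iff.2 h] with ω hω
  ext j
  exact hω j

variable [IsProbabilityMeasure μ]

lemma measure_exists_lt_norm_innerMap_sq_le {G : Type*} [NormedAddCommGroup G] [NormedSpace ℝ G]
    (X : Fin n → Ω → EuclideanSpace ℝ (Fin K)) {T : Matrix (Fin K) (Fin K) ℝ}
    (hT : T.PosSemidef) (hX : ∀ i, HasLaw (X i) (multivariateGaussian 0 T) μ)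
    (hind : iIndepFun X μ) (hKn : K ≤ n) (hn : n ≠ 0)
    (L : EuclideanSpace ℝ (Fin K) →L[ℝ] G)
    (hL : Function.Injective L) (s : ℝ) (hs : 0 ≤ s)
    (hTL : ∀ w : EuclideanSpace ℝ (Fin K), w.ofLp ⬝ᵥ T.mulVec w.ofLp ≤ s * ‖L w‖ ^ 2)
    (δ : ℝ) (hδ0 : 0 < δ) (hδ1 : δ < 1) :
    μ {ω | ∃ v, 16 * s * n * Real.log (4 / δ) * ‖L v‖ ^ 2 < ‖innerMap (X · ω) v‖ ^ 2} ≤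
      ENNReal.ofReal δ := by
  -- For `s = 0` the exponent `1 / (16 * s)` is meaningless, but all rows vanish almost surely.
  rcases hs.eq_or_lt with rfl | hs
  · have h0 : ∀ᵐ ω ∂μ, ∀ i, X i ω = 0 := ae_all_iff.2 fun i =>
      ae_eq_zero_of_quadratic_form_nonpos hT (hX i) fun w => by
        simpa using hTL (WithLp.toLp 2 w)
    have h1 : ∀ᵐ ω ∂μ, ¬ ∃ v, 16 * 0 * n * Real.log (4 / δ) * ‖L v‖ ^ 2 <
        ‖innerMap (X · ω) v‖ ^ 2 := by
      filter_upwards [h0] with ω hω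
      rintro ⟨v, hv⟩
      simp [norm_innerMap_sq, hω] at hv
    have h2 := ae_iff.1 h1
    simp only [not_not] at h2
    exact h2.le.trans zero_le
  set Y : Fin n → Ω → EuclideanSpace ℝ (Fin K) := fun i => (hX i).aemeasurable.mk (X i) with hY
  have hXY : ∀ i, X i =ᵐ[μ] Y i := fun i => (hX i).aemeasurable.ae_eq_mk
  have hYm : ∀ i, Measurable (Y i) := fun i => (hX i).aemeasurable.measurable_mk
  have hYl : ∀ i, HasLaw (Y i) (multivariateGaussian 0 T) μ := fun i =>
    (hX i).congr (hXY i).symm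
  -- Since `K ≤ n`, this threshold makes `2 ^ K * 2 ^ n / c` at most `δ`.
  set c : ENNReal := ENNReal.ofReal (4 ^ n / δ) with hc
  have hl : ((4 : ℝ) ^ n / δ) ≤ Real.exp (n * Real.log (4 / δ)) := by
    rw [Real.exp_nat_mul, Real.exp_log (by positivity), div_pow]
    gcongr
    exact pow_le_of_le_one hδ0.le hδ1.le hn
  -- On `‖L w‖ ≤ 2` the variance is at most `4 * s`, so `a = 1 / (16 * s)` is the largest value with
  -- `4 * a * (4 * s) ≤ 1`.
  have h := measure_exists_exp_norm_innerMap_sq_ge_le Y hYm (hind.congr hXY) L hL (1 / (16 * s))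
    (by positivity) (fun w hw i => by
      have h1 := (hasLaw_inner_multivariateGaussian hT (hYl i) w).lintegral_comp
        (f := fun x => ENNReal.ofReal (Real.exp (1 / (16 * s) * x ^ 2))) (by fun_prop)
      rw [h1]
      refine lintegral_exp_mul_sq_gaussianReal_le _ _ ?_
      have h2 : w.ofLp ⬝ᵥ T.mulVec w.ofLp ≤ 4 * s := by
        have h3 := hTL w
        have h4 : ‖L w‖ ^ 2 ≤ 2 ^ 2 := pow_le_pow_left₀ (norm_nonneg _) hw 2
        nlinarith
      have h3 : ((w.ofLp ⬝ᵥ T.mulVec w.ofLp).toNNReal : ℝ) ≤ 4 * s := by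
        rw [Real.coe_toNNReal']
        exact max_le h2 (by positivity)
      rw [mul_one_div, div_mul_eq_mul_div, div_le_one (by positivity)]
      linarith) c (by simp [hc]; positivity) ENNReal.ofReal_ne_top
  have hbound : (2 : ENNReal) ^ Module.finrank ℝ (EuclideanSpace ℝ (Fin K)) *
      2 ^ Fintype.card (Fin n) / c ≤ ENNReal.ofReal δ := by
    rw [finrank_euclideanSpace_fin, Fintype.card_fin]
    calc _ ≤ (2 : ENNReal) ^ n * 2 ^ n / c := by
          gcongr
          exact one_le_two
      _ = ENNReal.ofReal (4 ^ n / (4 ^ n / δ)) := by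
          rw [ENNReal.ofReal_div_of_pos (by positivity), ENNReal.ofReal_pow (by norm_num),
            ENNReal.ofReal_ofNat, ← mul_pow, hc]
          norm_num
      _ = ENNReal.ofReal δ := by
          congr 1
          field_simp
  refine le_trans (measure_mono_ae ?_) (h.trans hbound)
  filter_upwards [ae_all_iff.2 hXY] with ω hω
  rintro ⟨v, hv⟩
  have hXYω : (X · ω) = (Y · ω) := funext hω
  have hLv : 0 < ‖L v‖ := by
    rw [norm_pos_iff]
    intro h0
    rw [← map_zero L] at h0
    rw [hL h0] at hv
    simp at hv
  refine ⟨‖L v‖⁻¹ • v, ?_, ?_⟩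
  · rw [map_smul, norm_smul, norm_inv, norm_norm, inv_mul_cancel₀ hLv.ne']
  · refine ENNReal.ofReal_le_ofReal (hl.trans (Real.exp_le_exp.2 ?_))
    rw [map_smul, norm_smul, norm_inv, norm_norm, ← hXYω, mul_pow, inv_pow, ← div_eq_inv_mul,
      div_mul_eq_mul_div, one_mul, le_div_iff₀ (by positivity), le_div_iff₀ (by positivity)]
    nlinarith

end Gaussian

end ProjEst

/-! ### The main theorem. -/

theorem mainTheorem1 (δ : ℝ) (hδ0 : 0 < δ) (hδ1 : δ < 1) :
    ∃ d D : ℝ, 0 < d ∧ 0 < D ∧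
      ∀ (n K : ℕ) (H : Matrix (Fin n) (Fin K) ℝ) (S : Matrix (Fin K) (Fin K) ℝ) (γ : ℝ)
        (Ω : Type*) [MeasurableSpace Ω] (μ : Measure Ω) [IsProbabilityMeasure μ]
        (E : Ω → Matrix (Fin n) (Fin K) ℝ),
        H.rank = K →
        S.PosSemidef →
        (∀ i : Fin n,
          HasLaw (fun ω => ProjEst.rowVec (E ω) i) (multivariateGaussian 0 (γ ^ 2 • S)) μ) →
        iIndepFun (fun (i : Fin n) (ω : Ω) => ProjEst.rowVec (E ω) i) μ →
        1 / 4 * ProjEst.rhoMin (H.transpose * H) > d * n * γ ^ 2 * ProjEst.rho S →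
        ENNReal.ofReal (1 - δ) ≤ μ {ω |
          1 / (n : ℝ) * ‖ProjEst.proj H - ProjEst.proj (H + E ω)‖ ^ 2 ≤
              D * γ ^ 2 * ProjEst.condNumber (H.transpose * H) ^ 3 *
                (ProjEst.rho S / ProjEst.rhoMin (H.transpose * H)) ∧
          1 / (n : ℝ) * ‖ProjEst.proj H - ProjEst.proj (H + E ω)‖ ^ 2 ≤
              D * γ ^ 2 * ProjEst.condNumber (H.transpose * H) *
                max
                  (max
                    ((K : ℝ) / n * ProjEst.condNumber (H.transpose * H) ^ 2 *
                      ProjEst.rho (S * (H.transpose * H)⁻¹))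
                    (ProjEst.rho (S * (H.transpose * H)⁻¹)))
                  (ProjEst.condNumber (H.transpose * H) ^ 2 *
                    (S.trace / (n * ProjEst.rhoMin (H.transpose * H))))} := by
  have hlog : 0 < Real.log (4 / δ) := Real.log_pos (by rw [lt_div_iff₀ hδ0]; linarith)
  -- `256 = 4² * 16`: the squared projection constant times the concentration constant. Any `d > 0`
  -- would do, since the spectral gap assumption enters only through `0 < rhoMin G`.
  refine ⟨1, 256 * Real.log (4 / δ), one_pos, by positivity, ?_⟩
  intro n K H S γ Ω _ μ _ E hrank hS hlaw hind hmin
  have hinj : Function.Injective H.mulVec := by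
    have h1 := H.mulVecLin.finrank_range_add_finrank_ker
    rw [← Matrix.rank, hrank, Module.finrank_fin_fun] at h1
    have h2 : Module.finrank ℝ (LinearMap.ker H.mulVecLin) = 0 := by omega
    exact LinearMap.ker_eq_bot.1 (Submodule.finrank_eq_zero.1 h2)
  set G := H.transpose * H with hGdef
  have hG : G.PosDef := by
    have := Matrix.PosDef.conjTranspose_mul_self H hinj
    rwa [Matrix.conjTranspose_eq_transpose_of_trivial] at this
  have hρS : 0 ≤ ProjEst.rho S := by
    simpa using ProjEst.rho_nonneg hS (Matrix.PosDef.one (n := Fin K) (R := ℝ))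
  have hm : 0 < ProjEst.rhoMin G := by
    have : 0 ≤ 1 * (n : ℝ) * γ ^ 2 * ProjEst.rho S := by positivity
    linarith
  have hKn : K ≤ n := by
    have := H.rank_le_card_height
    rwa [hrank, Fintype.card_fin] at this
  have hn : n ≠ 0 := by
    rintro rfl
    obtain rfl : K = 0 := by omega
    -- For `K = 0` the spectrum is empty and `sInf ∅ = 0`, against `hm`.
    simp [ProjEst.rhoMin, spectrum.of_subsingleton] at hm
  have hκ : 1 ≤ ProjEst.condNumber G := ProjEst.one_le_condNumber hm
  set r := ProjEst.rho (S * G⁻¹) with hr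
  have hr0 : 0 ≤ r := ProjEst.rho_nonneg hS hG
  have hrle : r ≤ ProjEst.rho S / ProjEst.rhoMin G := ProjEst.rho_mul_inv_le hS hG hm
  set L : EuclideanSpace ℝ (Fin K) →L[ℝ] EuclideanSpace ℝ (Fin n) :=
    (Matrix.toEuclideanLin H).toContinuousLinearMap with hLdef
  have hLapp : ∀ w : EuclideanSpace ℝ (Fin K), L w = WithLp.toLp 2 (H.mulVec w.ofLp) :=
    fun w => rfl
  have hL : Function.Injective L := by
    intro x y hxy
    rw [hLapp, hLapp] at hxy
    exact WithLp.ofLp_injective 2 (hinj (WithLp.toLp_injective 2 hxy))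
  have hquad : ∀ w : EuclideanSpace ℝ (Fin K),
      w.ofLp ⬝ᵥ (γ ^ 2 • S).mulVec w.ofLp ≤ (γ ^ 2 * r) * ‖L w‖ ^ 2 := by
    intro w
    have h1 := (ProjEst.posSemidef_rho_smul_sub hS.isHermitian hG).dotProduct_mulVec_nonneg w.ofLp
    have h2 : ‖L w‖ ^ 2 = w.ofLp ⬝ᵥ G.mulVec w.ofLp := by
      rw [hLapp, EuclideanSpace.norm_sq_eq, hGdef, ← Matrix.mulVec_mulVec,
        Matrix.dotProduct_mulVec, Matrix.vecMul_transpose]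
      simp [dotProduct, sq]
    rw [Matrix.sub_mulVec, Matrix.smul_mulVec, dotProduct_sub, dotProduct_smul, star_trivial,
      ← h2, smul_eq_mul] at h1
    rw [Matrix.smul_mulVec, dotProduct_smul, smul_eq_mul, mul_assoc]
    exact mul_le_mul_of_nonneg_left (by linarith) (sq_nonneg γ)
  have hbad := ProjEst.measure_exists_lt_norm_innerMap_sq_le
    (fun i ω => ProjEst.rowVec (E ω) i) (hS.smul (sq_nonneg γ)) hlaw hind hKn hn L hL
    (γ ^ 2 * r) (by positivity) hquad δ hδ0 hδ1
  set bad := {ω | ∃ v, 16 * (γ ^ 2 * r) * n * Real.log (4 / δ) * ‖L v‖ ^ 2 <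
    ‖ProjEst.innerMap (fun i => ProjEst.rowVec (E ω) i) v‖ ^ 2} with hbaddef
  -- Subadditivity suffices, so `bad` need not be measurable.
  have hgood : ENNReal.ofReal (1 - δ) ≤ μ badᶜ := by
    have h1 : (1 : ENNReal) ≤ μ bad + μ badᶜ := by
      have := measure_union_le (μ := μ) bad badᶜ
      rwa [Set.union_compl_self, measure_univ] at this
    rw [ENNReal.ofReal_sub _ hδ0.le, ENNReal.ofReal_one, tsub_le_iff_left]
    exact h1.trans (by gcongr)
  refine hgood.trans (measure_mono fun ω hω => ?_)
  have hω' : ∀ v, ‖ProjEst.innerMap (fun i => ProjEst.rowVec (E ω) i) v‖ ^ 2 ≤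
      16 * (γ ^ 2 * r) * n * Real.log (4 / δ) * ‖L v‖ ^ 2 := by
    intro v
    by_contra! h
    exact hω ⟨v, h⟩
  have hn' : (0 : ℝ) < n := by positivity
  set C := 16 * (γ ^ 2 * r) * n * Real.log (4 / δ) with hC
  have hC0 : 0 ≤ C := by positivity
  have hproj : ‖ProjEst.proj H - ProjEst.proj (H + E ω)‖ ≤ 4 * √C := by
    refine ProjEst.norm_proj_sub_le H (E ω) (√C) (Real.sqrt_nonneg _) fun w => ?_
    have h1 := hω' (WithLp.toLp 2 w)
    have h2 : ProjEst.innerMap (fun i => ProjEst.rowVec (E ω) i) (WithLp.toLp 2 w) =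
        WithLp.toLp 2 ((E ω).mulVec w) := by
      ext i
      simp [ProjEst.rowVec, Matrix.mulVec, PiLp.inner_apply, dotProduct, mul_comm]
    rw [h2, hLapp] at h1
    refine le_of_sq_le_sq ?_ (by positivity)
    rwa [mul_pow, Real.sq_sqrt hC0]
  have hmain : 1 / (n : ℝ) * ‖ProjEst.proj H - ProjEst.proj (H + E ω)‖ ^ 2 ≤
      256 * Real.log (4 / δ) * γ ^ 2 * r := by
    have h1 := pow_le_pow_left₀ (norm_nonneg _) hproj 2
    rw [mul_pow, Real.sq_sqrt hC0] at h1
    rw [one_div, inv_mul_le_iff₀ hn']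
    refine h1.trans (le_of_eq ?_)
    rw [hC]
    ring
  refine ⟨hmain.trans ?_, hmain.trans ?_⟩
  · have hκ3 := one_le_pow₀ hκ (n := 3)
    have h1 : 0 ≤ 256 * Real.log (4 / δ) * γ ^ 2 := by positivity
    calc 256 * Real.log (4 / δ) * γ ^ 2 * r
        ≤ 256 * Real.log (4 / δ) * γ ^ 2 * (ProjEst.rho S / ProjEst.rhoMin G) :=
          mul_le_mul_of_nonneg_left hrle h1
      _ ≤ _ := mul_le_mul_of_nonneg_right (le_mul_of_one_le_right h1 hκ3) (hr0.trans hrle)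
  · have h1 : 0 ≤ 256 * Real.log (4 / δ) * γ ^ 2 := by positivity
    refine mul_le_mul (le_mul_of_one_le_right h1 hκ)
      ((le_max_right _ _).trans (le_max_left _ _)) hr0 (by positivity)
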